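/- Let $p$ be a prime, $R$ a commutative ring of characteristic $p$, and let $r,m$ be positive integers with $r+1<m$. Let $S=R[x_1,\dots,x_m]$ with its standard grading and let $V_r(S)=\bigoplus_{k\ge 0}S_{rk}$ be its $r$-th Veronese subring. Let $A=T(V_r(S))=\bigoplus_{e\ge0}A_e$, $A_e=S_{r(p^e-1)}$, be the associated twisted ring, i.e. the $\mathbb N$-graded ring whose multiplication is $a\star b=ab^{p^e}$ for $a\in A_e$, $b\in A_{e'}$. For $e\ge 0$ let $G_e$ be the subring of $A$ generated by the homogeneous elements of degree $\le e$, put $G_{-1}=A_0$, and let $c_e=c_e(A)$ be the minimal number of generators of the left $A_0$-module $A_e/(G_{e-1})_e$. For $k\in\mathbb Z$ let $M_{p,m}(k)$ be the coefficient of $T^k$ in $(1+T+\cdots+T^{p-1})^m$ (so it is $0$ for $k<0$), let $U$ be the $(m-r-1)\times(m-r-1)$ matrix with entries $u_{ij}=M_{p,m}(r(p-1)+ip-j)$, $1\le i,j\le m-r-1$, and let $m(T)=T^s+a_1T^{s-1}+\cdots+a_s\in\mathbb Q[T]$ be its minimal polynomial. Then all the $c_e$ are finite, and $$c_{e+s}+a_1c_{e+s-1}+\cdots+a_sc_e=0\qquad\text{for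 all } e\ge 2.$$ Equivalently, there is a polynomial $P(T)\in\mathbb Q[T]$ with $\deg P<s$ such that, in $\mathbb Q[[T]]$, $$\sum_{e\ge0}c_eT^e=c_0+c_1T+T^2\,\frac{P(T)}{Q(T)},\qquad Q(T)=T^s\,m(1/T)=1+a_1T+\cdots+a_sT^s .$$ -/

import Mathlib

open scoped DirectSum

/-! ### The complexity sequence of an `ℕ`-graded ring -/

section Complexity

variable (A : ℕ → Type*) [∀ i, AddCommGroup (A i)] [DirectSum.GRing A]

/-- The subring `G_e(A)` of the (possibly noncommutative) graded ring `A = ⨁ e, A e` generated by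
the homogeneous elements of degree `≤ e`. -/
def genSubring (e : ℕ) : Subring (DirectSum ℕ A) :=
  Subring.closure {x | ∃ i ≤ e, ∃ a : A i, x = DirectSum.of A i a}

/-- The subring `A_0` of `A`. -/
def degreeZeroSubring : Subring (DirectSum ℕ A) :=
  (DirectSum.ofZeroRingHom A).range

/-- The subring `G_{e-1}(A)`, with the convention `G_{-1}(A) = A_0`. -/
def prevGenSubring : ℕ → Subring (DirectSum ℕ A)
  | 0 => degreeZeroSubring A
  | e + 1 => genSubring A e

theorem of_mem_prevGenSubring (e : ℕ) (a : A 0) :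
    DirectSum.of A 0 a ∈ prevGenSubring A e := by
  cases e with
  | zero => exact ⟨a, rfl⟩
  | succ e => exact Subring.subset_closure ⟨0, Nat.zero_le _, a, rfl⟩

/-- The degree `e` part `(G_{e-1}(A))_e`, as a left `A_0`-submodule of `A_e`. -/
def decomposablePart (e : ℕ) : Submodule (A 0) (A e) where
  carrier := {a | DirectSum.of A e a ∈ prevGenSubring A e}
  zero_mem' := by
    simp only [Set.mem_ofPred_eq, map_zero]
    exact (prevGenSubring A e).zero_mem
  add_mem' {a b} ha hb := by
    simp only [Set.mem_ofPred_eq, map_add] at *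
    exact (prevGenSubring A e).add_mem ha hb
  smul_mem' c a ha := by
    simp only [Set.mem_ofPred_eq, DirectSum.of_zero_smul] at *
    exact (prevGenSubring A e).mul_mem (of_mem_prevGenSubring A e c) ha

/-- The left `A_0`-module `A_e / (G_{e-1}(A))_e`. -/
abbrev IndecomposableQuotient (e : ℕ) : Type _ := A e ⧸ decomposablePart A e

/-- The complexity sequence: `c_e(A)` is the minimal number of generators of
`A_e / (G_{e-1}(A))_e` as a left `A_0`-module. -/
noncomputable def complexitySeq (e : ℕ) : ℕ :=
  (⊤ : Submodule (A 0) (IndecomposableQuotient A e)).spanFinrank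

/-- The generating function `∑ c_e(A) T ^ e`, with rational coefficients. -/
noncomputable def complexityGenFun : PowerSeries ℚ :=
  PowerSeries.mk fun e => (complexitySeq A e : ℚ)

end Complexity

/-! ### Veronese subrings and the twisted construction -/

section Twisted

variable {R S : Type*} [CommRing R] [CommRing S] [Algebra R S]

/-- The graded pieces of the `r`-th Veronese subring `⨁ k, 𝒜 (r * k)` of the graded ring
`⨁ k, 𝒜 k`. -/
def veronese (r : ℕ) (𝒜 : ℕ → Submodule R S) (k : ℕ) : Submodule R S := 𝒜 (r * k)

instance veronese.gradedMonoid (r : ℕ) (𝒜 : ℕ → Submodule R S) [SetLike.GradedMonoid 𝒜] :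
    SetLike.GradedMonoid (veronese r 𝒜) where
  one_mem := by
    show (1 : S) ∈ 𝒜 (r * 0)
    rw [Nat.mul_zero]
    exact SetLike.GradedOne.one_mem
  mul_mem i j a b ha hb := by
    show a * b ∈ 𝒜 (r * (i + j))
    rw [Nat.mul_add]
    exact SetLike.GradedMul.mul_mem ha hb

/-- The degree `e` piece `𝒜_{p ^ e - 1}` of the twisted ring `T(⨁ k, 𝒜 k)`. -/
def Twisted (p : ℕ) (𝒜 : ℕ → Submodule R S) (e : ℕ) : Type _ := 𝒜 (p ^ e - 1)

namespace Twisted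

variable (p : ℕ) (𝒜 : ℕ → Submodule R S)

instance addCommGroup (e : ℕ) : AddCommGroup (Twisted p 𝒜 e) :=
  inferInstanceAs (AddCommGroup (𝒜 (p ^ e - 1)))

variable {p 𝒜}

/-- The underlying element of the ambient commutative ring. -/
def val {e : ℕ} (a : Twisted p 𝒜 e) : S := Subtype.val (p := fun x => x ∈ 𝒜 (p ^ e - 1)) a

theorem val_mem {e : ℕ} (a : Twisted p 𝒜 e) : a.val ∈ 𝒜 (p ^ e - 1) := Subtype.property a

/-- An element of `𝒜_{p ^ e - 1}` as an element of degree `e` of the twisted ring. -/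
def mk {e : ℕ} (x : S) (hx : x ∈ 𝒜 (p ^ e - 1)) : Twisted p 𝒜 e := ⟨x, hx⟩

@[simp] theorem val_mk {e : ℕ} (x : S) (hx : x ∈ 𝒜 (p ^ e - 1)) :
    (mk x hx : Twisted p 𝒜 e).val = x := rfl

@[simp] theorem val_zero {e : ℕ} : (0 : Twisted p 𝒜 e).val = 0 := rfl

@[simp] theorem val_add {e : ℕ} (a b : Twisted p 𝒜 e) : (a + b).val = a.val + b.val := rfl

theorem val_injective {e : ℕ} : Function.Injective (val : Twisted p 𝒜 e → S) :=
  Subtype.val_injective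

theorem sigma_ext {i j : ℕ} (h : i = j) (a : Twisted p 𝒜 i) (b : Twisted p 𝒜 j)
    (hab : a.val = b.val) :
    (⟨i, a⟩ : GradedMonoid (Twisted p 𝒜)) = ⟨j, b⟩ := by
  subst h
  rw [val_injective hab]

theorem index_add (hp : 0 < p) (i j : ℕ) :
    (p ^ i - 1) + p ^ i • (p ^ j - 1) = p ^ (i + j) - 1 := by
  have hi : 0 < p ^ i := Nat.pow_pos hp
  have hj : p ^ i * 1 ≤ p ^ i * p ^ j := Nat.mul_le_mul_left _ (Nat.pow_pos hp)
  rw [smul_eq_mul, Nat.mul_sub, pow_add]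
  omega

variable [SetLike.GradedMonoid 𝒜]

/-- The twisted multiplication: `a ⋆ b = a * b ^ (p ^ e)` for `a` of degree `e`. -/
instance gMul [hp : Fact p.Prime] : GradedMonoid.GMul (Twisted p 𝒜) where
  mul {i _} a b := mk (a.val * b.val ^ p ^ i) (by
    have h := SetLike.mul_mem_graded a.val_mem (SetLike.pow_mem_graded (p ^ i) b.val_mem)
    rwa [index_add hp.out.pos] at h)

/-- The unit, in degree `0`. -/
instance gOne : GradedMonoid.GOne (Twisted p 𝒜) where
  one := mk 1 (by simpa using SetLike.GradedOne.one_mem (A := 𝒜))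

@[simp] theorem val_gMul [Fact p.Prime] {i j : ℕ} (a : Twisted p 𝒜 i) (b : Twisted p 𝒜 j) :
    (GradedMonoid.GMul.mul a b).val = a.val * b.val ^ p ^ i := rfl

@[simp] theorem val_gOne : (GradedMonoid.GOne.one : Twisted p 𝒜 0).val = 1 := rfl

instance gMonoid [hp : Fact p.Prime] : GradedMonoid.GMonoid (Twisted p 𝒜) where
  one_mul := fun ⟨_, a⟩ => sigma_ext (zero_add _) _ _ (by
    show (GradedMonoid.GMul.mul GradedMonoid.GOne.one a).val = a.val
    simp)
  mul_one := fun ⟨_, a⟩ => sigma_ext (add_zero _) _ _ (by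
    show (GradedMonoid.GMul.mul a GradedMonoid.GOne.one).val = a.val
    simp)
  mul_assoc := fun ⟨i, a⟩ ⟨j, b⟩ ⟨_, c⟩ => sigma_ext (add_assoc _ _ _) _ _ (by
    show (GradedMonoid.GMul.mul (GradedMonoid.GMul.mul a b) c).val =
      (GradedMonoid.GMul.mul a (GradedMonoid.GMul.mul b c)).val
    simp only [val_gMul]
    rw [mul_pow, ← pow_mul, mul_assoc, pow_add, mul_comm (p ^ j)])

/-- In characteristic `p` the twisted multiplication makes `⨁ e, 𝒜_{p ^ e - 1}` a graded ring. -/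
instance gRing [hp : Fact p.Prime] [CharP S p] : DirectSum.GRing (Twisted p 𝒜) where
  mul_zero a := val_injective (by simp [hp.out.ne_zero])
  zero_mul b := val_injective (by simp)
  mul_add a b c := val_injective (by simp [add_pow_char_pow, mul_add])
  add_mul a b c := val_injective (by simp [add_mul])
  natCast n := n • GradedMonoid.GOne.one
  natCast_zero := zero_nsmul _
  natCast_succ n := succ_nsmul _ _
  intCast z := z • GradedMonoid.GOne.one
  intCast_ofNat n := natCast_zsmul _ _
  intCast_negSucc_ofNat n := negSucc_zsmul _ _

end Twisted

end Twisted

/-- The graded pieces of `T(V_r(R[x_1, …, x_m]))`, for the standard grading of the polynomial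
ring. -/
abbrev TwistedVeronese (R : Type*) [CommRing R] (p r m : ℕ) : ℕ → Type _ :=
  Twisted p (veronese r (MvPolynomial.homogeneousSubmodule (Fin m) R))

/-! ### The matrix `U` -/

/-- `M_{p,m}(k)`: the coefficient of `T ^ k` in `(1 + T + ⋯ + T ^ (p - 1)) ^ m`, which is `0` for
negative `k`. -/
noncomputable def cubeCoeff (p m : ℕ) (k : ℤ) : ℕ :=
  if k < 0 then 0
  else ((∑ i ∈ Finset.range p, (Polynomial.X : Polynomial ℕ) ^ i) ^ m).coeff k.toNat

/-- The matrix `U = (M_{p,m}(r(p-1) + ip - j))`, `1 ≤ i, j ≤ m - r - 1` (rows and columns are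
indexed from `0` here). -/
noncomputable def matrixU (p r m : ℕ) : Matrix (Fin (m - r - 1)) (Fin (m - r - 1)) ℚ :=
  Matrix.of fun i j =>
    (cubeCoeff p m ((r : ℤ) * ((p : ℤ) - 1) + ((i : ℤ) + 1) * (p : ℤ) - ((j : ℤ) + 1)) : ℚ)

/-! In positive degree `e`, the quotient `A_e / (G_{e-1})_e` is free over `A_0` on the monomials
`x^γ` of degree `r(p^e - 1)` that are not twisted products, so `c_e` counts such `γ`.

Since `∑ γ + r = r p^e`, for `0 < i < e` one has `∑ (γ mod p^i) + r = c p^i`: here `c` is the carry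
into position `i` when the entries of `γ` and the number `r` are added in base `p`. A factorization
`γ = α + p^i β` with the required degrees exists exactly when `c ≤ r`
(`not_decomposableExponent_iff`). Also `c < m`, because each residue is at most `p^i - 1` and `r <
m`. Indecomposability therefore means that every intermediate carry is one of the `m - r - 1` values
`r + 1, …, m - 1`.

A digit vector takes carry `s` to carry `t` when its sum is `pt - s`, so `U` is the transfer matrix
between carries (`natCard_carryVectors_succ`, `natCard_carryVectors_Iio`). The lowest digits start
from the addend `r` and the leading part is not bounded by `p`; these two ends give vectors `v` and
`w` with `c_{n+2} = w · U^n v`. The minimal polynomial of `U` then gives the recurrence from degree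
2 on. -/

/-! ### Counting digit vectors by their carries -/

section DigitCounting

/-- Vectors of `m` naturals taken from `H` whose sum plus `s` is `t`. -/
def digitVectors (m : ℕ) (H : Set ℕ) (s t : ℕ) : Set (Fin m → ℕ) :=
  {h | (∀ k, h k ∈ H) ∧ ∑ k, h k + s = t}

/-- Vectors `γ` with `∑ γ + r = p ^ (n + 1) * t`, with leading parts `γ / p ^ n` in `H`, all of whose
carries at the positions `1, …, n` exceed `r`. -/
def carryVectors (p r m : ℕ) (H : Set ℕ) (n t : ℕ) : Set (Fin m → ℕ) :=
  {γ | (∀ k, γ k / p ^ n ∈ H) ∧ ∑ k, γ k + r = p ^ (n + 1) * t ∧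
    ∀ i, 0 < i → i < n + 1 → r * p ^ i < ∑ k, γ k % p ^ i + r}

theorem finite_setOf_sum_le (m N : ℕ) : {h : Fin m → ℕ | ∑ k, h k ≤ N}.Finite := by
  refine (Set.finite_Iic (fun _ : Fin m => N)).subset fun h hh k => ?_
  exact (Finset.single_le_sum (fun i _ => Nat.zero_le (h i)) (Finset.mem_univ k)).trans hh

theorem digitVectors_finite (m : ℕ) (H : Set ℕ) (s t : ℕ) : (digitVectors m H s t).Finite :=
  (finite_setOf_sum_le m t).subset fun h hh => by
    have := hh.2
    show ∑ k, h k ≤ t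
    omega

theorem carryVectors_finite (p r m : ℕ) (H : Set ℕ) (n t : ℕ) :
    (carryVectors p r m H n t).Finite :=
  (finite_setOf_sum_le m (p ^ (n + 1) * t)).subset fun h hh => by
    have := hh.2.1
    show ∑ k, h k ≤ _
    omega

theorem natCard_digitVectors_Iio (p m s t : ℕ) :
    Nat.card (digitVectors m (Set.Iio p) s t) = cubeCoeff p m ((t : ℤ) - s) := by
  classical
  unfold cubeCoeff
  split_ifs with hlt
  · rw [Nat.card_eq_zero]
    left
    refine ⟨fun h => ?_⟩
    have := h.2.2
    omega
  · obtain ⟨k, hk⟩ := Int.eq_ofNat_of_zero_le (not_lt.mp hlt)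
    have ht : t = k + s := by omega
    subst ht
    have hpow : (∑ i ∈ Finset.range p, (Polynomial.X : Polynomial ℕ) ^ i) ^ m =
        ∑ h ∈ Fintype.piFinset fun _ : Fin m => Finset.range p, Polynomial.X ^ (∑ k, h k) := by
      have := Finset.prod_univ_sum (fun _ : Fin m => Finset.range p)
        (fun _ i => (Polynomial.X : Polynomial ℕ) ^ i)
      simpa [Finset.prod_pow_eq_pow_sum] using this
    rw [hpow, hk]
    simp only [Int.toNat_natCast, Polynomial.finsetSum_coeff, Polynomial.coeff_X_pow]
    rw [Finset.sum_boole, Nat.card_coe_set_eq, ← Set.ncard_coe_finset]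
    simp only [Nat.cast_id]
    congr 1
    ext h
    simp [digitVectors, eq_comm]

theorem add_pow_mul_mod {p i n : ℕ} (hi : i ≤ n) (a b : ℕ) :
    (a + p ^ n * b) % p ^ i = a % p ^ i := by
  obtain ⟨d, rfl⟩ := Nat.exists_eq_add_of_le hi
  rw [pow_add, mul_assoc, Nat.add_mul_mod_self_left]

/-- The carry transfer: the vectors with `n + 2` digits are obtained from those with `n + 1` digits
by adding a leading digit vector. -/
theorem natCard_carryVectors_succ (p r m : ℕ) (hp : 0 < p) (hrm : r + 1 < m) (H : Set ℕ)
    (n t : ℕ) :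
    Nat.card (carryVectors p r m H (n + 1) t) =
      ∑ s : Fin (m - r - 1), Nat.card (carryVectors p r m (Set.Iio p) n (r + 1 + s)) *
        Nat.card (digitVectors m H (r + 1 + s) (p * t)) := by
  have hq : 0 < p ^ (n + 1) := Nat.pow_pos hp
  have key (γ : Fin m → ℕ) :
      ∑ k, γ k = ∑ k, γ k % p ^ (n + 1) + p ^ (n + 1) * ∑ k, γ k / p ^ (n + 1) := by
    rw [Finset.mul_sum, ← Finset.sum_add_distrib]
    exact Finset.sum_congr rfl fun k _ => (Nat.mod_add_div _ _).symm
  have hfin (s : Fin (m - r - 1)) :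
      Finite (carryVectors p r m (Set.Iio p) n (r + 1 + s)) :=
    carryVectors_finite ..
  have hfin' (s : Fin (m - r - 1)) : Finite (digitVectors m H (r + 1 + s) (p * t)) :=
    digitVectors_finite ..
  have hlow {l : Fin m → ℕ} {s : ℕ} (hl : l ∈ carryVectors p r m (Set.Iio p) n s) (k : Fin m) :
      l k < p ^ (n + 1) := by
    have := hl.1 k
    rw [Set.mem_Iio, Nat.div_lt_iff_lt_mul (Nat.pow_pos hp)] at this
    rwa [pow_succ']
  simp_rw [← Nat.card_prod]
  rw [← Nat.card_sigma]
  symm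
  let f : (Σ s : Fin (m - r - 1), carryVectors p r m (Set.Iio p) n (r + 1 + s) ×
      digitVectors m H (r + 1 + s) (p * t)) → carryVectors p r m H (n + 1) t :=
    fun x => ⟨fun k => x.2.1.1 k + p ^ (n + 1) * x.2.2.1 k, by
      obtain ⟨s, ⟨l, hl⟩, ⟨h, hh⟩⟩ := x
      refine ⟨fun k => ?_, ?_, fun i hi hi' => ?_⟩
      · simp only
        rw [Nat.add_mul_div_left _ _ hq, Nat.div_eq_of_lt (hlow hl k), zero_add]
        exact hh.1 k
      · have h1 := hl.2.1
        have h2 := hh.2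
        simp only
        rw [Finset.sum_add_distrib, ← Finset.mul_sum, pow_succ _ (n + 1), mul_assoc, ← h2, mul_add,
          ← h1]
        ring
      · simp only [add_pow_mul_mod (Nat.lt_succ_iff.mp hi')]
        rcases (Nat.lt_succ_iff.mp hi').eq_or_lt with rfl | hlt
        · simp only [Nat.mod_eq_of_lt (hlow hl _)]
          rw [hl.2.1, mul_comm]
          exact Nat.mul_lt_mul_of_pos_left (by omega) hq
        · exact hl.2.2 i hi hlt⟩
  refine Nat.card_congr (Equiv.ofBijective f ⟨?_, ?_⟩)
  · rintro ⟨s, ⟨l, hl⟩, ⟨h, hh⟩⟩ ⟨s', ⟨l', hl'⟩, ⟨h', hh'⟩⟩ heq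
    have heq (k : Fin m) : l k + p ^ (n + 1) * h k = l' k + p ^ (n + 1) * h' k :=
      congrFun (congrArg Subtype.val heq) k
    have e1 : l = l' := funext fun k => by
      have := congrArg (· % p ^ (n + 1)) (heq k)
      simpa [Nat.mod_eq_of_lt (hlow hl k), Nat.mod_eq_of_lt (hlow hl' k)] using this
    subst e1
    have e2 : h = h' := funext fun k => Nat.eq_of_mul_eq_mul_left hq (Nat.add_left_cancel (heq k))
    subst e2
    have e3 : s = s' := by
      have := hh.2.trans hh'.2.symm
      exact Fin.ext (by omega)
    subst e3
    rfl
  · rintro ⟨γ, hγ⟩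
    obtain ⟨h1, h2, h3⟩ := hγ
    -- The quotient `c` is the carry out of the lowest `n + 1` digits; the bounds `r < c < m` make
    -- it a state `r + 1 + s`.
    have hdvd : p ^ (n + 1) ∣ ∑ k, γ k % p ^ (n + 1) + r := by
      have : p ^ (n + 1) ∣ ∑ k, γ k + r := h2 ▸ ⟨p * t, by ring⟩
      rw [key, add_right_comm] at this
      exact (Nat.dvd_add_left (Dvd.intro _ rfl)).mp this
    obtain ⟨c, hc⟩ := hdvd
    have hrc : r < c := by
      have := h3 (n + 1) (by omega) (by omega)
      rw [hc, mul_comm] at this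
      exact Nat.lt_of_mul_lt_mul_left this
    have hcm : c < m := by
      have hsum : ∑ k, γ k % p ^ (n + 1) + m ≤ m * p ^ (n + 1) := by
        calc ∑ k, γ k % p ^ (n + 1) + m = ∑ k : Fin m, (γ k % p ^ (n + 1) + 1) := by
              simp [Finset.sum_add_distrib]
          _ ≤ ∑ _k : Fin m, p ^ (n + 1) := Finset.sum_le_sum fun k _ => Nat.mod_lt _ hq
          _ = m * p ^ (n + 1) := by simp
      rw [mul_comm m] at hsum
      exact Nat.lt_of_mul_lt_mul_left (a := p ^ (n + 1)) (by omega)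
    have hcs : r + 1 + (c - r - 1) = c := by omega
    refine ⟨⟨⟨c - r - 1, by omega⟩, ⟨fun k => γ k % p ^ (n + 1), fun k => ?_, ?_, fun i hi hi' => ?_⟩,
      ⟨fun k => γ k / p ^ (n + 1), h1, ?_⟩⟩, ?_⟩
    · rw [Set.mem_Iio, Nat.div_lt_iff_lt_mul (Nat.pow_pos hp), ← pow_succ']
      exact Nat.mod_lt _ hq
    · simp only [hcs]
      exact hc
    · simp only [Nat.mod_mod_of_dvd _ (pow_dvd_pow p hi'.le)]
      exact h3 i hi (by omega)
    · simp only [hcs]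
      refine Nat.eq_of_mul_eq_mul_left hq ?_
      rw [← mul_assoc, ← pow_succ, ← h2, key γ, mul_add, ← hc]
      ring
    · exact Subtype.ext (funext fun k => Nat.mod_add_div _ _)

-- Carries `t = r + 1 + i` and `s = r + 1 + j`, with `i`, `j` counted from 0, give `pt - s = r(p-1)
-- + (i+1)p - (j+1)`, the argument in the entry of `U`.
open Matrix in
theorem natCard_carryVectors_Iio (p r m : ℕ) (hp : 0 < p) (hrm : r + 1 < m) (n : ℕ) :
    (fun i : Fin (m - r - 1) =>
        (Nat.card (carryVectors p r m (Set.Iio p) n (r + 1 + i)) : ℚ)) =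
      matrixU p r m ^ n *ᵥ
        fun i => (Nat.card (carryVectors p r m (Set.Iio p) 0 (r + 1 + i)) : ℚ) := by
  induction n with
  | zero => simp
  | succ n ih =>
    rw [pow_succ', ← mulVec_mulVec, ← ih]
    funext i
    rw [natCard_carryVectors_succ p r m hp hrm, mulVec, dotProduct]
    push_cast
    refine Finset.sum_congr rfl fun s _ => ?_
    rw [natCard_digitVectors_Iio, mul_comm, matrixU, of_apply]
    congr 3
    push_cast
    ring

end DigitCounting

/-! ### Indecomposable monomials in terms of carries -/

section Decomposable

/-- An exponent vector of degree `r * (p ^ e - 1)` is decomposable if the corresponding monomial is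
a twisted product of monomials of smaller positive degrees. -/
def DecomposableExponent {m : ℕ} (p r e : ℕ) (γ : Fin m →₀ ℕ) : Prop :=
  ∃ i j, 0 < i ∧ 0 < j ∧ i + j = e ∧ ∃ α β : Fin m →₀ ℕ,
    α.degree = r * (p ^ i - 1) ∧ β.degree = r * (p ^ j - 1) ∧ γ = α + p ^ i • β

/-- The indecomposable exponent vectors of degree `r * (p ^ e - 1)`. -/
def indecomposableExponents (p r m e : ℕ) : Set (Fin m →₀ ℕ) :=
  {γ | γ.degree = r * (p ^ e - 1) ∧ ¬ DecomposableExponent p r e γ}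

/-- In a factorization `γ = α + p^i β` the residues of `γ` mod `p^i` are those of `α`, so their sum
is at most `r(p^i - 1)`. Conversely, if the carry `c` is at most `r`, the residues form an `α` of
too small degree, and the deficit `(r - c)p^i` can be borrowed from the quotient part. -/
theorem not_decomposableExponent_iff {p r m e : ℕ} (hp : 0 < p) {γ : Fin m →₀ ℕ}
    (hγ : γ.degree = r * (p ^ e - 1)) :
    ¬ DecomposableExponent p r e γ ↔
      ∀ i, 0 < i → i < e → r * p ^ i < ∑ k, γ k % p ^ i + r := by
  have hpos (i : ℕ) : 0 < p ^ i := Nat.pow_pos hp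
  have hdeg (i : ℕ) : r * (p ^ i - 1) + r = r * p ^ i := by
    rw [← Nat.mul_succ, Nat.succ_eq_add_one, Nat.sub_add_cancel (hpos i)]
  constructor
  · intro h i hi hie
    by_contra! hle
    obtain ⟨j, rfl⟩ := Nat.exists_eq_add_of_lt hie
    set l : Fin m →₀ ℕ := γ.mapRange (· % p ^ i) (Nat.zero_mod _) with hl
    set f : Fin m →₀ ℕ := γ.mapRange (· / p ^ i) (Nat.zero_div _) with hf
    have hlf : γ = l + p ^ i • f := by
      ext k
      simp [hl, hf, Nat.mod_add_div]
    have hldeg : l.degree = ∑ k, γ k % p ^ i := by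
      rw [Finsupp.degree_eq_sum]
      rfl
    rw [← hldeg] at hle
    have hsum : l.degree + r + p ^ i * f.degree = p ^ i * (r * p ^ (j + 1)) := by
      have := hdeg (i + j + 1)
      rw [← hγ, hlf, map_add, map_nsmul, smul_eq_mul, add_assoc i, pow_add] at this
      linarith
    obtain ⟨c, hc⟩ : p ^ i ∣ l.degree + r :=
      (Nat.dvd_add_left (Dvd.intro _ rfl)).mp (hsum ▸ Dvd.intro _ rfl)
    have hcr : c ≤ r := by
      rw [hc, mul_comm] at hle
      exact Nat.le_of_mul_le_mul_right hle (hpos i)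
    have hcf : c + f.degree = r * p ^ (j + 1) := by
      rw [hc, ← mul_add] at hsum
      exact Nat.eq_of_mul_eq_mul_left (hpos i) hsum
    have hrj : r * 1 ≤ r * p ^ (j + 1) := Nat.mul_le_mul_left _ (hpos _)
    -- Moving `p^i δ` to the low part raises its degree from `c p^i - r` to `r p^i - r`; the
    -- quotient `f` has degree `r p^(j+1) - c`, enough to contain `δ`.
    obtain ⟨δ, hδ, hδdeg⟩ := f.exists_le_degree_eq (r - c) (by omega)
    obtain ⟨β, hβ⟩ := le_iff_exists_add.mp hδ
    refine h ⟨i, j + 1, hi, j.succ_pos, (add_assoc _ _ _).symm, l + p ^ i • δ, β, ?_, ?_, ?_⟩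
    · rw [map_add, map_nsmul, hδdeg, smul_eq_mul]
      have h1 := hdeg i
      obtain ⟨d, rfl⟩ := Nat.exists_eq_add_of_le hcr
      rw [Nat.add_sub_cancel_left]
      have h2 : (c + d) * p ^ i = p ^ i * c + p ^ i * d := by ring
      omega
    · have h1 := hdeg (j + 1)
      rw [hβ, map_add, hδdeg] at hcf
      omega
    · rw [hlf, hβ, smul_add, add_assoc]
  · rintro h ⟨i, j, hi, hj, rfl, α, β, hα, -, rfl⟩
    have h1 := h i hi (by omega)
    have h2 : ∑ k, (α + p ^ i • β) k % p ^ i ≤ α.degree := by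
      rw [Finsupp.degree_eq_sum]
      refine Finset.sum_le_sum fun k _ => ?_
      simp only [Finsupp.coe_add, Finsupp.coe_smul, Pi.add_apply, Pi.smul_apply, smul_eq_mul,
        Nat.add_mul_mod_self_left]
      exact Nat.mod_le _ _
    have h3 := hdeg i
    omega

theorem natCard_indecomposableExponents {p r m : ℕ} (hp : 0 < p) (n : ℕ) :
    Nat.card (indecomposableExponents p r m (n + 1)) =
      Nat.card (carryVectors p r m Set.univ n r) := by
  refine Nat.card_congr (Finsupp.equivFunOnFinite.subtypeEquiv fun γ => ?_)
  have hdeg : γ.degree = r * (p ^ (n + 1) - 1) ↔ ∑ k, γ k + r = p ^ (n + 1) * r := by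
    have : r * (p ^ (n + 1) - 1) + r = p ^ (n + 1) * r := by
      rw [← Nat.mul_succ, Nat.succ_eq_add_one, Nat.sub_add_cancel (Nat.pow_pos hp), mul_comm]
    rw [Finsupp.degree_eq_sum]
    omega
  constructor
  · rintro ⟨h1, h2⟩
    exact ⟨fun _ => trivial, hdeg.mp h1, (not_decomposableExponent_iff hp h1).mp h2⟩
  · rintro ⟨-, h1, h2⟩
    exact ⟨hdeg.mpr h1, (not_decomposableExponent_iff hp (hdeg.mpr h1)).mpr h2⟩

theorem indecomposableExponents_finite (p r m e : ℕ) :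
    (indecomposableExponents p r m e).Finite := by
  refine ((finite_setOf_sum_le m (r * (p ^ e - 1))).preimage
    (DFunLike.coe_injective (F := Fin m →₀ ℕ)).injOn).subset fun γ hγ => ?_
  have := hγ.1
  rw [Finsupp.degree_eq_sum] at this
  exact this.le

end Decomposable

/-! ### The degree zero ring and Frobenius powers -/

namespace Twisted

variable {R S : Type*} [CommRing R] [CommRing S] [Algebra R S] {p : ℕ} {𝒜 : ℕ → Submodule R S}

/-- The inclusion of the degree `e` piece of the twisted ring, as an additive map. -/
def valHom (e : ℕ) : Twisted p 𝒜 e →+ S where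
  toFun := val
  map_zero' := val_zero
  map_add' := val_add

theorem val_sum {e : ℕ} {ι : Type*} (s : Finset ι) (f : ι → Twisted p 𝒜 e) :
    (∑ i ∈ s, f i).val = ∑ i ∈ s, (f i).val :=
  map_sum (valHom e) f s

variable [Fact p.Prime] [SetLike.GradedMonoid 𝒜]

theorem val_smul {e : ℕ} (c : Twisted p 𝒜 0)
    (a : Twisted p 𝒜 e) : (c • a).val = c.val * a.val := by
  have := congrArg (fun x : GradedMonoid (Twisted p 𝒜) => x.2.val)
    (GradedMonoid.mk_zero_smul c a)
  refine this.trans ?_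
  show (GradedMonoid.GMul.mul c a).val = _
  simp

variable [CharP S p]

theorem val_mul (c d : Twisted p 𝒜 0) :
    (c * d).val = c.val * d.val :=
  val_smul c d

theorem val_one :
    (1 : Twisted p 𝒜 0).val = 1 := rfl

/-- `A_0` is commutative, as its twist is by `p^0 = 1`, and nontrivial. Rank is thus well defined,
so that the minimal number of generators of a free module can be read off a basis. -/
instance strongRankCondition :
    StrongRankCondition (Twisted p 𝒜 0) := by
  let _ : CommRing (Twisted p 𝒜 0) :=
    { (inferInstance : Ring (Twisted p 𝒜 0)) with
      mul_comm := fun a b => val_injective (by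
        show (a * b).val = (b * a).val
        rw [val_mul, val_mul, mul_comm]) }
  have : Nontrivial S := CharP.nontrivial_of_char_ne_one (Fact.out : p.Prime).ne_one
  have : Nontrivial (Twisted p 𝒜 0) := ⟨⟨0, 1, fun h => by
    have := congrArg val h
    rw [val_zero, val_one] at this
    exact zero_ne_one this⟩⟩
  exact commRing_strongRankCondition _

end Twisted

theorem MvPolynomial.exists_of_coeff_pow_char_pow_ne_zero {σ R : Type*} [CommRing R] {p : ℕ}
    [Fact p.Prime] [CharP R p] {f : MvPolynomial σ R} {i : ℕ} {γ : σ →₀ ℕ}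
    (h : coeff γ (f ^ p ^ i) ≠ 0) : ∃ β, coeff β f ≠ 0 ∧ γ = p ^ i • β := by
  classical
  rw [f.as_sum, sum_pow_char_pow, coeff_sum] at h
  obtain ⟨β, hβ, hne⟩ := Finset.exists_ne_zero_of_sum_ne_zero h
  rw [monomial_pow, coeff_monomial] at hne
  refine ⟨β, mem_support_iff.mp hβ, ?_⟩
  by_contra hc
  exact hne (if_neg fun h => hc h.symm)

/-! ### Freeness of the indecomposable quotient -/

namespace TwistedVeronese

open MvPolynomial

variable {R : Type*} [CommRing R] {p : ℕ} {r m : ℕ}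

theorem isHomogeneous_val {e : ℕ} (a : TwistedVeronese R p r m e) :
    a.val.IsHomogeneous (r * (p ^ e - 1)) :=
  a.val_mem

/-- A monomial as an element of the twisted ring. -/
noncomputable def ofMonomial {e : ℕ} (γ : Fin m →₀ ℕ) (hγ : γ.degree = r * (p ^ e - 1)) (c : R) :
    TwistedVeronese R p r m e :=
  Twisted.mk (monomial γ c) (isHomogeneous_monomial c hγ)

theorem val_ofMonomial {e : ℕ} (γ : Fin m →₀ ℕ) (hγ : γ.degree = r * (p ^ e - 1)) (c : R) :
    (ofMonomial γ hγ c).val = monomial γ c := rfl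

theorem eq_sum_ofMonomial {e : ℕ} (a : TwistedVeronese R p r m e) :
    a = ∑ γ ∈ a.val.support.attach, ofMonomial γ.1
      (by_contra fun h => mem_support_iff.mp γ.2 ((isHomogeneous_val a).coeff_eq_zero h))
      (a.val.coeff γ.1) := by
  apply Twisted.val_injective
  rw [Twisted.val_sum]
  simp only [val_ofMonomial]
  rw [Finset.sum_attach a.val.support fun γ => monomial γ (a.val.coeff γ)]
  exact a.val.as_sum

theorem val_eq_C (a : TwistedVeronese R p r m 0) : a.val = C (coeff 0 a.val) := by
  have := isHomogeneous_val a
  rw [pow_zero, Nat.sub_self, mul_zero, ← totalDegree_zero_iff_isHomogeneous] at this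
  exact totalDegree_eq_zero_iff_eq_C.mp this

variable [Fact p.Prime]

theorem coeff_val_smul {e : ℕ} (c : TwistedVeronese R p r m 0) (a : TwistedVeronese R p r m e)
    (γ : Fin m →₀ ℕ) : coeff γ (c • a).val = coeff 0 c.val * coeff γ a.val := by
  rw [Twisted.val_smul, val_eq_C c, coeff_C_mul, coeff_C, if_pos rfl]

variable [CharP R p]

/-- A twisted product has only decomposable exponents, unless one of its factors has top degree. -/
theorem coeff_gMul_eq_zero {i j n : ℕ} (hij : i + j = n)
    (a : TwistedVeronese R p r m i) (b : TwistedVeronese R p r m j) {γ : Fin m →₀ ℕ}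
    (hγ : ¬ DecomposableExponent p r n γ) (ha : i = n → coeff γ a.val = 0)
    (hb : j = n → coeff γ b.val = 0) : coeff γ (GradedMonoid.GMul.mul a b).val = 0 := by
  classical
  rw [Twisted.val_gMul]
  -- A factor of degree 0 is a constant and only rescales coefficients of the other, top-degree
  -- factor.
  rcases Nat.eq_zero_or_pos i with rfl | hi
  · rw [val_eq_C a, pow_zero, pow_one, coeff_C_mul, hb (by omega), mul_zero]
  rcases Nat.eq_zero_or_pos j with rfl | hj
  · rw [val_eq_C b, ← C_pow, mul_comm, coeff_C_mul, ha (by omega), mul_zero]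
  by_contra hne
  rw [coeff_mul] at hne
  obtain ⟨⟨α, β'⟩, hmem, hne⟩ := Finset.exists_ne_zero_of_sum_ne_zero hne
  obtain ⟨β, hβ, hβ'⟩ := exists_of_coeff_pow_char_pow_ne_zero (right_ne_zero_of_mul hne)
  have hsum : α + β' = γ := Finset.HasAntidiagonal.mem_antidiagonal.mp hmem
  refine hγ ⟨i, j, hi, hj, hij, α, β, ?_, ?_, ?_⟩
  · exact by_contra fun h =>
      left_ne_zero_of_mul hne ((isHomogeneous_val a).coeff_eq_zero h)
  · exact by_contra fun h => hβ ((isHomogeneous_val b).coeff_eq_zero h)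
  · rw [← hsum, ← hβ']

variable (R p r m) in
/-- The elements whose component in degree `n` involves decomposable exponents only. -/
noncomputable def decomposableSubring (n : ℕ) (hn : 0 < n) :
    Subring (DirectSum ℕ (TwistedVeronese R p r m)) where
  carrier := {x | ∀ γ, ¬ DecomposableExponent p r n γ → coeff γ (x n).val = 0}
  zero_mem' γ _ := by simp
  one_mem' γ _ := by
    rw [DirectSum.one_def, DirectSum.of_eq_of_ne _ _ _ hn.ne']
    simp
  add_mem' {x y} hx hy γ hγ := by
    simp [hx γ hγ, hy γ hγ]
  neg_mem' {x} hx γ hγ := by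
    have : (-x) n + x n = 0 := by rw [← DirectSum.add_apply, neg_add_cancel, DirectSum.zero_apply]
    have := congrArg (fun z : TwistedVeronese R p r m n => coeff γ z.val) this
    simpa [hx γ hγ] using this
  mul_mem' {x y} hx hy γ hγ := by
    classical
    rw [DirectSum.mul_eq_sum_support_ghas_mul, DFinsupp.finsetSum_apply, Twisted.val_sum,
      coeff_sum]
    refine Finset.sum_eq_zero fun ij _ => ?_
    rcases eq_or_ne (ij.1 + ij.2) n with rfl | hne
    · rw [DirectSum.of_eq_same]
      refine coeff_gMul_eq_zero rfl _ _ hγ (fun h => ?_) fun h => ?_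
      · have := hx γ hγ
        rwa [← h] at this
      · have := hy γ hγ
        rwa [← h] at this
    · rw [DirectSum.of_eq_of_ne _ _ _ hne.symm, Twisted.val_zero, coeff_zero]

/-- The condition on coefficients cuts out a subring containing all generators of degree at most
`n`, since their component in degree `n + 1` is zero. Conversely, each decomposable monomial is a
product of two generators. -/
theorem mem_decomposablePart_iff {n : ℕ} (a : TwistedVeronese R p r m (n + 1)) :
    a ∈ decomposablePart (TwistedVeronese R p r m) (n + 1) ↔
      ∀ γ, ¬ DecomposableExponent p r (n + 1) γ → coeff γ a.val = 0 := by
  constructor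
  · intro ha
    have hle : prevGenSubring (TwistedVeronese R p r m) (n + 1) ≤
        decomposableSubring R p r m (n + 1) n.succ_pos := by
      refine Subring.closure_le.mpr ?_
      rintro _ ⟨i, hi, b, rfl⟩ γ -
      rw [DirectSum.of_eq_of_ne _ _ _ (by omega), Twisted.val_zero, coeff_zero]
    intro γ hγ
    have := hle ha γ hγ
    rwa [DirectSum.of_eq_same] at this
  · intro ha
    rw [eq_sum_ofMonomial a]
    refine Submodule.sum_mem _ fun γ _ => ?_
    obtain ⟨γ, hγ⟩ := γ
    obtain ⟨i, j, hi, hj, hij, α, β, hα, hβ, rfl⟩ :=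
      not_not.mp fun h => mem_support_iff.mp hγ (ha γ h)
    have hgen {k : ℕ} (hk : k ≤ n) (b : TwistedVeronese R p r m k) :
        DirectSum.of (TwistedVeronese R p r m) k b ∈
          prevGenSubring (TwistedVeronese R p r m) (n + 1) :=
      Subring.subset_closure ⟨k, hk, b, rfl⟩
    -- The coefficient goes into the left factor, because the right one is raised to the power
    -- `p^i`.
    have hmul := mul_mem (hgen (by omega) (ofMonomial α hα (coeff (α + p ^ i • β) a.val)))
      (hgen (by omega) (ofMonomial β hβ 1))
    rw [DirectSum.of_mul_of] at hmul
    have heq : DirectSum.of (TwistedVeronese R p r m) (i + j) (GradedMonoid.GMul.mul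
        (ofMonomial α hα (coeff (α + p ^ i • β) a.val)) (ofMonomial β hβ 1)) =
        DirectSum.of (TwistedVeronese R p r m) (n + 1) (ofMonomial (α + p ^ i • β)
          (by_contra fun h => mem_support_iff.mp hγ ((isHomogeneous_val a).coeff_eq_zero h))
          (coeff (α + p ^ i • β) a.val)) := by
      refine DirectSum.of_eq_of_gradedMonoid_eq (Twisted.sigma_ext hij _ _ ?_)
      rw [Twisted.val_gMul, val_ofMonomial, val_ofMonomial, val_ofMonomial, monomial_pow,
        monomial_mul, one_pow, mul_one]
    rw [heq] at hmul
    exact hmul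

variable (R p r m) in
/-- The coefficients at the indecomposable exponents. -/
noncomputable def indecomposableCoeffs (e : ℕ) :
    TwistedVeronese R p r m e →ₗ[TwistedVeronese R p r m 0]
      (indecomposableExponents p r m e → TwistedVeronese R p r m 0) where
  toFun a γ := ofMonomial 0 (by simp) (coeff γ.1 a.val)
  map_add' a b := funext fun γ => Twisted.val_injective <| by
    rw [Pi.add_apply, Twisted.val_add, val_ofMonomial, Twisted.val_add, val_ofMonomial,
      val_ofMonomial, coeff_add, map_add]
  map_smul' c a := funext fun γ => Twisted.val_injective <| by
    rw [RingHom.id_apply, Pi.smul_apply, smul_eq_mul, Twisted.val_mul, val_ofMonomial,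
      val_ofMonomial, coeff_val_smul, val_eq_C c, coeff_C, if_pos rfl, ← C_apply, ← C_apply, C_mul]

theorem indecomposableCoeffs_surjective (e : ℕ) :
    Function.Surjective (indecomposableCoeffs R p r m e) := by
  classical
  intro f
  have := (indecomposableExponents_finite p r m e).fintype
  refine ⟨∑ γ, ofMonomial γ.1 γ.2.1 (coeff 0 (f γ).val), funext fun δ => Twisted.val_injective ?_⟩
  show monomial 0 (coeff δ.1 (Twisted.val _)) = _
  rw [val_eq_C (f δ), Twisted.val_sum, coeff_sum, C_apply]
  simp [val_ofMonomial, coeff_monomial, Subtype.val_inj]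

theorem ker_indecomposableCoeffs (n : ℕ) :
    LinearMap.ker (indecomposableCoeffs R p r m (n + 1)) =
      decomposablePart (TwistedVeronese R p r m) (n + 1) := by
  ext a
  have hval : indecomposableCoeffs R p r m (n + 1) a = 0 ↔
      ∀ γ : indecomposableExponents p r m (n + 1), coeff γ.1 a.val = 0 := by
    rw [funext_iff]
    refine forall_congr' fun γ => (Twisted.val_injective.eq_iff.symm).trans ?_
    show monomial 0 (coeff γ.1 a.val) = (0 : MvPolynomial (Fin m) R) ↔ _
    exact monomial_eq_zero
  rw [LinearMap.mem_ker, hval, mem_decomposablePart_iff]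
  refine ⟨fun h γ hγ => ?_, fun h γ => h γ.1 γ.2.2⟩
  by_contra hne
  exact hne (h ⟨γ, by_contra fun hd => hne ((isHomogeneous_val a).coeff_eq_zero hd), hγ⟩)

variable (R p r m) in
/-- In positive degree, `A_e / (G_{e-1})_e` is free on the indecomposable exponents. -/
noncomputable def indecomposableQuotientEquiv (n : ℕ) :
    IndecomposableQuotient (TwistedVeronese R p r m) (n + 1) ≃ₗ[TwistedVeronese R p r m 0]
      (indecomposableExponents p r m (n + 1) → TwistedVeronese R p r m 0) :=
  (Submodule.quotEquivOfEq _ _ (ker_indecomposableCoeffs n).symm).trans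
    (LinearMap.quotKerEquivOfSurjective _ (indecomposableCoeffs_surjective (n + 1)))

theorem finite_indecomposableQuotient (e : ℕ) :
    Module.Finite (TwistedVeronese R p r m 0)
      (IndecomposableQuotient (TwistedVeronese R p r m) e) := by
  cases e with
  | zero =>
    have : Module.Finite (TwistedVeronese R p r m 0) (TwistedVeronese R p r m 0) :=
      Module.Finite.self _
    exact Module.Finite.of_surjective _ (Submodule.mkQ_surjective _)
  | succ n =>
    have := (indecomposableExponents_finite p r m (n + 1)).fintype
    exact Module.Finite.equiv (indecomposableQuotientEquiv R p r m n).symm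

theorem complexitySeq_succ (n : ℕ) :
    complexitySeq (TwistedVeronese R p r m) (n + 1) =
      Nat.card (carryVectors p r m Set.univ n r) := by
  have := (indecomposableExponents_finite p r m (n + 1)).fintype
  have := Module.Free.of_equiv (indecomposableQuotientEquiv R p r m n).symm
  rw [complexitySeq, ← Module.finrank_eq_spanFinrank_of_free,
    (indecomposableQuotientEquiv R p r m n).finrank_eq, Module.finrank_fintype_fun_eq_card,
    ← Nat.card_eq_fintype_card, natCard_indecomposableExponents (Fact.out : p.Prime).pos]

open Matrix in
/-- The transfer matrix formula for the complexity sequence. -/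
theorem complexitySeq_add_two (hrm : r + 1 < m) (n : ℕ) :
    (complexitySeq (TwistedVeronese R p r m) (n + 2) : ℚ) =
      (fun s : Fin (m - r - 1) => (Nat.card (digitVectors m Set.univ (r + 1 + s) (p * r)) : ℚ)) ⬝ᵥ
        (matrixU p r m ^ n *ᵥ
          fun i => (Nat.card (carryVectors p r m (Set.Iio p) 0 (r + 1 + i)) : ℚ)) := by
  have hp : 0 < p := (Fact.out : p.Prime).pos
  rw [complexitySeq_succ, natCard_carryVectors_succ p r m hp hrm,
    ← natCard_carryVectors_Iio p r m hp hrm, dotProduct]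
  push_cast
  exact Finset.sum_congr rfl fun s _ => mul_comm _ _

end TwistedVeronese

/-! ### Recurrences from minimal polynomials and rational generating functions -/

open Matrix in
theorem Matrix.minpoly_recurrence {K ι : Type*} [Field K] [Fintype ι] [DecidableEq ι]
    (M : Matrix ι ι K) (w v : ι → K) (n : ℕ) :
    w ⬝ᵥ (M ^ (n + (minpoly K M).natDegree) *ᵥ v) +
      ∑ j ∈ Finset.Icc 1 (minpoly K M).natDegree,
        (minpoly K M).coeff ((minpoly K M).natDegree - j) *
          (w ⬝ᵥ (M ^ (n + ((minpoly K M).natDegree - j)) *ᵥ v)) = 0 := by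
  set q := minpoly K M with hq
  have hmonic : q.Monic := minpoly.monic (Algebra.IsIntegral.isIntegral M)
  have hz : w ⬝ᵥ ((M ^ n * Polynomial.aeval M q) *ᵥ v) = 0 := by
    rw [hq, minpoly.aeval]
    simp
  -- Reversing the sum puts the leading term first, where it splits off with coefficient 1.
  rw [Polynomial.aeval_eq_sum_range, Finset.mul_sum, Matrix.sum_mulVec, dotProduct_sum,
    ← Finset.sum_range_reflect, Finset.sum_range_succ'] at hz
  have hIcc : Finset.Icc 1 q.natDegree = (Finset.range q.natDegree).map (addRightEmbedding 1) := by
    rw [Finset.range_eq_Ico, Finset.map_add_right_Ico]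
    rfl
  rw [← hz, add_comm, hIcc, Finset.sum_map]
  congr 1
  · refine Finset.sum_congr rfl fun j _ => ?_
    rw [addRightEmbedding_apply, show q.natDegree + 1 - 1 - (j + 1) = q.natDegree - (j + 1) by omega,
      mul_smul_comm, smul_mulVec, dotProduct_smul, ← pow_add, smul_eq_mul]
  · rw [show q.natDegree + 1 - 1 - 0 = q.natDegree by omega, hmonic.coeff_natDegree, one_smul,
      ← pow_add]

/-- The coefficients of the series times `q.reverse` at indices at least `q.natDegree` are the left
sides of the recurrence, so the product is a polynomial. Monicity gives `q.reverse` constant term 1,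
hence invertibility. -/
theorem PowerSeries.exists_eq_polynomial_mul_inv_reverse {K : Type*} [Field K]
    {q : Polynomial K} (hq : q.Monic) (c : ℕ → K)
    (hc : ∀ n, c (n + q.natDegree) +
      ∑ j ∈ Finset.Icc 1 q.natDegree, q.coeff (q.natDegree - j) * c (n + q.natDegree - j) = 0) :
    ∃ P : Polynomial K, P.degree < q.natDegree ∧
      PowerSeries.mk c = (P : PowerSeries K) * (q.reverse : PowerSeries K)⁻¹ := by
  have hconst : PowerSeries.constantCoeff (q.reverse : PowerSeries K) ≠ 0 := by
    rw [Polynomial.constantCoeff_coe, Polynomial.coeff_zero_reverse, hq.leadingCoeff]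
    exact one_ne_zero
  refine ⟨((PowerSeries.mk c) * (q.reverse : PowerSeries K)).trunc q.natDegree,
    PowerSeries.degree_trunc_lt _ _, ?_⟩
  rw [PowerSeries.eq_mul_inv_iff_mul_eq hconst]
  ext n
  rw [Polynomial.coeff_coe, PowerSeries.coeff_trunc]
  split_ifs with hn
  · rfl
  obtain ⟨n, rfl⟩ := Nat.exists_eq_add_of_le' (not_lt.mp hn)
  rw [mul_comm, PowerSeries.coeff_mul, Finset.Nat.sum_antidiagonal_eq_sum_range_succ_mk, ← hc n]
  simp only [Polynomial.coeff_coe, PowerSeries.coeff_mk]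
  -- Terms beyond `q.natDegree` vanish, as `q.reverse` has no larger degree.
  have hsub : Finset.range (q.natDegree + 1) ⊆ Finset.range (n + q.natDegree).succ :=
    Finset.range_subset_range.mpr (by omega)
  rw [← Finset.sum_subset hsub fun j _ hj => ?_]
  · have hIcc : Finset.Icc 1 q.natDegree =
        (Finset.range q.natDegree).map (addRightEmbedding 1) := by
      rw [Finset.range_eq_Ico, Finset.map_add_right_Ico]
      rfl
    rw [Finset.sum_range_succ', add_comm, hIcc, Finset.sum_map]
    congr 1
    · simp [Polynomial.coeff_zero_reverse, hq.leadingCoeff]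
    · refine Finset.sum_congr rfl fun j hj => ?_
      rw [Polynomial.coeff_reverse, Polynomial.revAt_le (Finset.mem_range.mp hj)]
      rfl
  · rw [Polynomial.coeff_eq_zero_of_natDegree_lt, zero_mul]
    exact (Polynomial.reverse_natDegree_le q).trans_lt (by simpa using hj)

theorem PowerSeries.mk_eq_add_add_X_sq_mul {K : Type*} [CommRing K] (c : ℕ → K) :
    PowerSeries.mk c = PowerSeries.C (c 0) + PowerSeries.C (c 1) * PowerSeries.X +
      PowerSeries.X ^ 2 * PowerSeries.mk fun n => c (n + 2) := by
  ext n
  rcases n with _ | _ | n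
  · simp
  · simp [PowerSeries.coeff_X_pow_mul', PowerSeries.coeff_C]
  · rw [map_add, map_add, show n + 1 + 1 = n + 2 from rfl, PowerSeries.coeff_X_pow_mul]
    simp

/-! ### The recurrence and the generating function -/

theorem theorem4 (R : Type*) [CommRing R] (p : ℕ) [Fact p.Prime] [CharP R p]
    (r m : ℕ) (hr : 1 ≤ r) (hrm : r + 1 < m) :
    -- all the numbers `c_e` are finite
    (∀ e, (⊤ : Submodule (TwistedVeronese R p r m 0)
      (IndecomposableQuotient (TwistedVeronese R p r m) e)).FG) ∧
    -- the linear recurrence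
    (∀ e, 2 ≤ e →
      (complexitySeq (TwistedVeronese R p r m) (e + (minpoly ℚ (matrixU p r m)).natDegree) : ℚ) +
        ∑ j ∈ Finset.Icc 1 (minpoly ℚ (matrixU p r m)).natDegree,
          (minpoly ℚ (matrixU p r m)).coeff ((minpoly ℚ (matrixU p r m)).natDegree - j) *
            (complexitySeq (TwistedVeronese R p r m)
              (e + (minpoly ℚ (matrixU p r m)).natDegree - j) : ℚ) = 0) ∧
    -- the generating function
    (∃ P : Polynomial ℚ, P.degree < (minpoly ℚ (matrixU p r m)).natDegree ∧
      complexityGenFun (TwistedVeronese R p r m) =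
        PowerSeries.C (complexitySeq (TwistedVeronese R p r m) 0 : ℚ) +
        PowerSeries.C (complexitySeq (TwistedVeronese R p r m) 1 : ℚ) * PowerSeries.X +
        PowerSeries.X ^ 2 *
          ((P : PowerSeries ℚ) *
            ((minpoly ℚ (matrixU p r m)).reverse : PowerSeries ℚ)⁻¹)) := by
  -- The shift by 2 reflects that the formula `w · U^n v` begins at `c_2`.
  have hrec (n : ℕ) :
      (complexitySeq (TwistedVeronese R p r m)
          (n + (minpoly ℚ (matrixU p r m)).natDegree + 2) : ℚ) +
        ∑ j ∈ Finset.Icc 1 (minpoly ℚ (matrixU p r m)).natDegree,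
          (minpoly ℚ (matrixU p r m)).coeff ((minpoly ℚ (matrixU p r m)).natDegree - j) *
            (complexitySeq (TwistedVeronese R p r m)
              (n + (minpoly ℚ (matrixU p r m)).natDegree - j + 2) : ℚ) = 0 := by
    simp only [TwistedVeronese.complexitySeq_add_two hrm]
    rw [← Matrix.minpoly_recurrence (matrixU p r m) _ _ n]
    refine congrArg _ (Finset.sum_congr rfl fun j hj => ?_)
    rw [Nat.add_sub_assoc (Finset.mem_Icc.mp hj).2]
  refine ⟨fun e => (TwistedVeronese.finite_indecomposableQuotient e).fg_top, fun e he => ?_, ?_⟩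
  · obtain ⟨n, rfl⟩ := Nat.exists_eq_add_of_le' he
    rw [← hrec n, add_right_comm]
    refine congrArg _ (Finset.sum_congr rfl fun j hj => ?_)
    have := (Finset.mem_Icc.mp hj).2
    congr 3
    omega
  · obtain ⟨P, hP, hmk⟩ := PowerSeries.exists_eq_polynomial_mul_inv_reverse
      (minpoly.monic (Algebra.IsIntegral.isIntegral (R := ℚ) (matrixU p r m)))
      (fun n => (complexitySeq (TwistedVeronese R p r m) (n + 2) : ℚ)) hrec
    refine ⟨P, hP, ?_⟩
    rw [← hmk, complexityGenFun]
    exact PowerSeries.mk_eq_add_add_X_sq_mul _
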